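/- \textbf{Theorem (Mean behaviour and subcriticality).} Let $M\in\mathbb N$. For all ordered pairs $(j,d)\in\{1,\dots,M\}^2$ let $g_{j\to d},h_{j\to d}$ be measurable kernels that are non-negative on $(0,\infty)$ with $\int_0^\infty g_{j\to d}(u)\,du=\int_0^\infty h_{j\to d}(u)\,du=1$, and let $K=(K_{j\to d})$ and $L=(L_{j\to d})$ be real $M\times M$ matrices with non-negative entries. For $d=1,\dots,M$ let the background rate $\mu_d:\mathbb R\to[0,\infty)$ be locally integrable (for a process started at time $0$, put $\mu_d=0$ on negative times). Consider the $M$-variate Ancestor Hawkes process with these parameters, given by its cluster representation: immigrant events arrive in dimension $d$ as a Poisson process on $\mathbb R$ with rate $\mu_d$; an immigrant event in dimension $j$ at time $s$ has its direct offspring in dimension $d$ at the points of a Poisson process on $(s,\infty)$ with rate $t\mapsto K_{j\to d}\,g_{j\to d}(t-s)$; a triggered event (an event which is the offspring of some event) in dimension $j$ at time $s$ has its direct offspring in dimension $d$ at the points of a Poisson process on $(s,\infty)$ with rate $t\mapsto L_{j\to d}\,h_{j\to d}(t-s)$; all these processes (for the offspring processes: of the delays after the parent) are independent. The process consists of all immigrant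 events and all their descendants. Let $t_i$ and $d_i$ be the time and the dimension of the event $i$; let $$\lambda^{\mathrm{tr}}_d(t)=\sum_{\substack{i\text{ immigrant}\\ t_i<t}}K_{d_i\to d}\,g_{d_i\to d}(t-t_i)+\sum_{\substack{i\text{ triggered}\\ t_i<t}}L_{d_i\to d}\,h_{d_i\to d}(t-t_i),\qquad \lambda_d(t)=\mu_d(t)+\lambda_d^{\mathrm{tr}}(t)$$ be the intensity of triggered events and the total intensity in dimension $d$, and let $r_d(t)=\mathbb E[\lambda^{\mathrm{tr}}_d(t)]$ and $m_d(t)=\mathbb E[\lambda_d(t)]$ be their means, with values in $[0,\infty]$. Suppose that the spectral radius of $L$ satisfies $\rho(L)<1$. Then: 1. (Subcriticality.) For every event, immigrant or triggered, the branching process that it starts (the event itself, its offspring, their offspring, and so on) has finite expected total size. 2. (Renewal system.) For all $d$ and all $t\in\mathbb R$, as an identity in $[0,\infty]$, $$r_d(t)=\sum_{j=1}^M K_{j\to d}\int_0^\infty g_{j\to d}(u)\,\mu_j(t-u)\,du+\sum_{j=1}^M L_{j\to d}\int_0^\infty h_{j\to d}(u)\,r_j(t-u)\,du .$$ 3. (Mean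 total intensity.) For all $d$ and $t$, $m_d(t)=\mu_d(t)+r_d(t)$. Moreover, for every Borel set $A\subseteq\mathbb R$, the expected number of triggered events in dimension $d$ with time in $A$ is $\int_A r_d(t)\,dt$, and the expected number of all events in dimension $d$ with time in $A$ is $\int_A m_d(t)\,dt$. 4. (Finiteness.) If for all $j$ and $T$ one has $\sup_{s\le T}\int_{s-1}^{s}\mu_j(t)\,dt<\infty$ (for instance if the $\mu_j$ vanish at negative times, or are bounded), then also $\sup_{s\le T}\int_{s-1}^{s}r_d(t)\,dt<\infty$ for all $d$ and $T$; in particular $r_d$ is locally integrable, and finite almost everywhere. -/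

import Mathlib

open MeasureTheory ProbabilityTheory
open scoped ENNReal NNReal

noncomputable section

namespace AncestorHawkes

/-- Parameters of the `M`-variate Ancestor Hawkes process. A pair of indices `j d` is read
`j → d`: `K j d` and `g j d` are the magnitude and the kernel of the influence of an immigrant
event in dimension `j` on dimension `d`; `L j d` and `h j d` are those of a triggered event. -/
structure Params (M : ℕ) where
  mu : Fin M → ℝ → ℝ
  K : Matrix (Fin M) (Fin M) ℝ
  L : Matrix (Fin M) (Fin M) ℝ
  g : Fin M → Fin M → ℝ → ℝ
  h : Fin M → Fin M → ℝ → ℝ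

/-- Labels of potential events: `immigrant d k` is the `k`-th immigrant in dimension `d`, and
`child p d k` is the `k`-th direct offspring of the event `p` in dimension `d`. So the label of an
event tells its dimension and its parent, hence whether it is an immigrant or triggered. -/
inductive Label (M : ℕ) : Type
  | immigrant (d : Fin M) (k : ℕ) : Label M
  | child (p : Label M) (d : Fin M) (k : ℕ) : Label M

/-- The dimension of an event. -/
def Label.dim {M : ℕ} : Label M → Fin M
  | .immigrant d _ => d
  | .child _ d _ => d

/-- The event is triggered, that is, it has a parent. -/
def Label.IsTriggered {M : ℕ} : Label M → Prop
  | .immigrant _ _ => False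
  | .child _ _ _ => True

/-- The rate at which an event produces direct offspring in dimension `d`, at a time `u > 0` after
the event: `K g` for an immigrant event and `L h` for a triggered event. -/
def Params.rate {M : ℕ} (θ : Params M) : Label M → Fin M → ℝ → ℝ
  | .immigrant j _, d, u => θ.K j d * θ.g j d u
  | .child _ j _, d, u => θ.L j d * θ.h j d u

/-- An enumerated configuration of points of the real line: the number of points, finite or
infinite, and their positions. The positions with an index not below the number of points are
ignored. -/
abbrev Config : Type := ℕ∞ × (ℕ → ℝ)

/-- The `k`-th point is present. -/
def Config.Has (c : Config) (k : ℕ) : Prop := (k : ℕ∞) < c.1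

/-- The counting measure of a configuration: `c.toMeasure A` is the number of points in `A`. -/
def Config.toMeasure (c : Config) : Measure ℝ :=
  Measure.sum fun k : {k : ℕ // c.Has k} => Measure.dirac (c.2 k)

/-- The random measure `N` is a Poisson process on the real line with intensity measure `ν`. -/
structure IsPoissonProcess {Ω : Type*} [MeasurableSpace Ω] (P : Measure Ω)
    (N : Ω → Measure ℝ) (ν : Measure ℝ) : Prop where
  law : ∀ A : Set ℝ, MeasurableSet A → ν A ≠ ∞ →
    P.map (fun ω => N ω A) = (poissonMeasure (ν A).toNNReal).map (fun n : ℕ => (n : ℝ≥0∞))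
  indep : ∀ (n : ℕ) (A : Fin n → Set ℝ), (∀ i, MeasurableSet (A i)) →
    Pairwise (fun i j => Disjoint (A i) (A j)) → iIndepFun (fun i ω => N ω (A i)) P

/-- The random elements of the cluster representation: `imm d` is the configuration of the
immigrant times in dimension `d`, and `off v d` is the configuration of the delays after which the
event with label `v` has its direct offspring in dimension `d`. -/
structure ClusterSystem (M : ℕ) (Ω : Type*) where
  imm : Fin M → Ω → Config
  off : Label M → Fin M → Ω → Config

namespace ClusterSystem

variable {M : ℕ} {Ω : Type*}

/-- The event labelled `v` is realised: its immigrant ancestor and all the intermediate offspring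
are present. -/
def Occurs (X : ClusterSystem M Ω) (ω : Ω) : Label M → Prop
  | .immigrant d k => (X.imm d ω).Has k
  | .child p d k => X.Occurs ω p ∧ (X.off p d ω).Has k

/-- The time of the event labelled `v` (meaningful if the event occurs). -/
def time (X : ClusterSystem M Ω) (ω : Ω) : Label M → ℝ
  | .immigrant d k => (X.imm d ω).2 k
  | .child p d k => X.time ω p + (X.off p d ω).2 k

/-- Membership in the branching process started by `v`: `w` is `v` itself, or a direct offspring of
a member that is present. If `v` occurs, the members are exactly the events that
descend from `v`, with `v` included. -/
def InCluster (X : ClusterSystem M Ω) (ω : Ω) (v : Label M) : Label M → Prop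
  | .immigrant d k => Label.immigrant d k = v
  | .child p d k => Label.child p d k = v ∨ (X.InCluster ω v p ∧ (X.off p d ω).Has k)

/-- The total size of the branching process started by `v`. -/
def clusterSize (X : ClusterSystem M Ω) (v : Label M) (ω : Ω) : ℝ≥0∞ :=
  (({w : Label M | X.InCluster ω v w}.encard : ℕ∞) : ℝ≥0∞)

/-- The number of all events in dimension `d` with time in `A`. -/
def count (X : ClusterSystem M Ω) (d : Fin M) (A : Set ℝ) (ω : Ω) : ℝ≥0∞ :=
  (({v : Label M | X.Occurs ω v ∧ v.dim = d ∧ X.time ω v ∈ A}.encard : ℕ∞) : ℝ≥0∞)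

/-- The number of triggered events in dimension `d` with time in `A`. -/
def triggeredCount (X : ClusterSystem M Ω) (d : Fin M) (A : Set ℝ) (ω : Ω) : ℝ≥0∞ :=
  (({v : Label M | X.Occurs ω v ∧ v.IsTriggered ∧ v.dim = d ∧ X.time ω v ∈ A}.encard : ℕ∞) : ℝ≥0∞)

/-- The intensity of triggered events in dimension `d` at time `t`: the sum, over all events `v`
before `t`, of `K g (t - t_v)` if `v` is an immigrant and of `L h (t - t_v)` if `v` is triggered. -/
def triggeredIntensity (X : ClusterSystem M Ω) (θ : Params M) (d : Fin M) (t : ℝ) (ω : Ω) : ℝ≥0∞ :=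
  ∑' v : {v : Label M // X.Occurs ω v ∧ X.time ω v < t},
    ENNReal.ofReal (θ.rate v.1 d (t - X.time ω v.1))

/-- The (total) intensity `λ_d(t)` of the Ancestor Hawkes process. -/
def intensity (X : ClusterSystem M Ω) (θ : Params M) (d : Fin M) (t : ℝ) (ω : Ω) : ℝ≥0∞ :=
  ENNReal.ofReal (θ.mu d t) + X.triggeredIntensity θ d t ω

/-- The mean intensity `r_d(t)` of triggered events. -/
def meanTriggered [MeasurableSpace Ω] (X : ClusterSystem M Ω) (θ : Params M) (P : Measure Ω)
    (d : Fin M) (t : ℝ) : ℝ≥0∞ :=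
  ∫⁻ ω, X.triggeredIntensity θ d t ω ∂P

/-- The mean total intensity `m_d(t)`. -/
def meanIntensity [MeasurableSpace Ω] (X : ClusterSystem M Ω) (θ : Params M) (P : Measure Ω)
    (d : Fin M) (t : ℝ) : ℝ≥0∞ :=
  ∫⁻ ω, X.intensity θ d t ω ∂P

/-- `X` is an Ancestor Hawkes process with parameters `θ`: immigrants arrive in dimension `d` as a
Poisson process with rate `mu d`, every event has its direct offspring in dimension `d` after
delays that form a Poisson process on `(0, ∞)` with rate `K g` (immigrant event) or `L h`
(triggered event), and all these Poisson processes are independent. -/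
structure IsAncestorHawkes [MeasurableSpace Ω] (X : ClusterSystem M Ω) (θ : Params M)
    (P : Measure Ω) : Prop where
  measurable_imm : ∀ d, Measurable (X.imm d)
  measurable_off : ∀ v d, Measurable (X.off v d)
  poisson_imm : ∀ d, IsPoissonProcess P (fun ω => (X.imm d ω).toMeasure)
    (volume.withDensity fun s => ENNReal.ofReal (θ.mu d s))
  poisson_off : ∀ v d, IsPoissonProcess P (fun ω => (X.off v d ω).toMeasure)
    ((volume.restrict (Set.Ioi 0)).withDensity fun u => ENNReal.ofReal (θ.rate v d u))
  indep : iIndepFun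
    (fun i : Fin M ⊕ (Label M × Fin M) => Sum.elim X.imm (fun q => X.off q.1 q.2) i) P

end ClusterSystem

end AncestorHawkes

end

noncomputable section

namespace AncestorHawkes

/-! Everything rests on Campbell's formula: the sum of `f` over a Poisson process with intensity
measure `ν` has mean `∫ f dν`. Whether and when an event occurs is decided by earlier generations,
so its offspring delays are independent of both and the formula applies with a random parameter
(`lintegral_off`). By Tonelli the triggered events then have mean measure `r_d(s) ds`
(`tsum_lintegral_child`), and the immigrants `μ_d(s) ds` (`tsum_lintegral_immigrant`). With `f` the
influence on a time `t` this is the renewal system; with `f` an indicator it gives the expected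
counts. These identities hold in `[0, ∞]`, with no finiteness to check.

For finiteness, let `B n d` be the supremum, over a class of test functions stable under `f ↦ f (· +
u)`, `u > 0`, of the mean sum of `f` over generation `n` in dimension `d`. The kernels have mass
one, so `B (n + 1) ≤ B n * L` from generation one on (`genMean_succ_le`), and the powers of `L` are
summable by Gelfand's formula. The class `{1}` bounds cluster sizes; indicators of unit windows
ending before `T` bound `r_d`. -/

/-! ### Poisson processes and Campbell's formula. -/

theorem lintegral_natCast_poissonMeasure (r : ℝ≥0) :
    ∫⁻ n : ℕ, (n : ℝ≥0∞) ∂(poissonMeasure r) = r := by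
  have key : ∀ n : ℕ, ENNReal.ofReal (Real.exp (-r) * r ^ (n + 1) / (n + 1).factorial) *
      ((n + 1 : ℕ) : ℝ≥0∞) = r * ENNReal.ofReal (Real.exp (-r) * r ^ n / n.factorial) := by
    intro n
    rw [← ENNReal.ofReal_natCast, ← ENNReal.ofReal_coe_nnreal,
      ← ENNReal.ofReal_mul (by positivity), ← ENNReal.ofReal_mul (by positivity)]
    congr 1
    have : (n.factorial : ℝ) ≠ 0 := by positivity
    rw [Nat.factorial_succ]
    push_cast
    field_simp
    ring
  rw [lintegral_countable']
  rw [tsum_eq_zero_add' ENNReal.summable]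
  simp only [Nat.cast_zero, zero_mul, zero_add, poissonMeasure_singleton]
  calc ∑' n : ℕ, ((n + 1 : ℕ) : ℝ≥0∞) *
        ENNReal.ofReal (Real.exp (-r) * r ^ (n + 1) / (n + 1).factorial)
      = ∑' n : ℕ, r * ENNReal.ofReal (Real.exp (-r) * r ^ n / n.factorial) := by
        refine tsum_congr fun n => ?_
        rw [mul_comm, key]
    _ = r := by
        rw [ENNReal.tsum_mul_left, ← ENNReal.ofReal_tsum_of_nonneg (fun n => by positivity)
          (hasSum_one_poissonMeasure r).summable, (hasSum_one_poissonMeasure r).tsum_eq]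
        simp

theorem Config.measurableSet_has (k : ℕ) : MeasurableSet {c : Config | c.Has k} :=
  measurable_fst (MeasurableSet.of_discrete (s := {n : ℕ∞ | (k : ℕ∞) < n}))

open Classical in
/-- The sum of `f` over the points of a configuration. -/
def Config.sum (c : Config) (f : ℝ → ℝ≥0∞) : ℝ≥0∞ :=
  ∑' k : ℕ, if c.Has k then f (c.2 k) else 0

open Classical in
theorem Config.lintegral_toMeasure (c : Config) {f : ℝ → ℝ≥0∞} (hf : Measurable f) :
    ∫⁻ x, f x ∂c.toMeasure = c.sum f := by
  rw [Config.toMeasure, lintegral_sum_measure, Config.sum]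
  simp_rw [lintegral_dirac' _ hf]
  refine (tsum_subtype {k | c.Has k} (fun k => f (c.2 k))).trans ?_
  simp [Set.indicator_apply]

open Classical in
theorem Config.measurable_toMeasure : Measurable Config.toMeasure := by
  refine Measure.measurable_of_measurable_coe _ fun A hA => ?_
  have : (fun c : Config => c.toMeasure A) = fun c => c.sum (A.indicator 1) := by
    funext c
    rw [← c.lintegral_toMeasure (measurable_one.indicator hA), lintegral_indicator_one hA]
  rw [this]
  refine Measurable.tsum fun k => Measurable.ite (Config.measurableSet_has k) ?_ ?_
  · exact (measurable_one.indicator hA).comp ((measurable_pi_apply k).comp measurable_snd)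
  · exact measurable_const

/-- On a set of finite `ν`-measure this is the mean of the Poisson law. Other sets are cut into
countably many such pieces by σ-finiteness. -/
theorem IsPoissonProcess.bind_eq {Ω : Type*} [MeasurableSpace Ω] {P : Measure Ω}
    {N : Ω → Measure ℝ} {ν : Measure ℝ} [SigmaFinite ν] (h : IsPoissonProcess P N ν)
    (hN : Measurable N) : P.bind N = ν := by
  have fin : ∀ A, MeasurableSet A → ν A ≠ ∞ → P.bind N A = ν A := by
    intro A hA hfin
    have hm : Measurable fun ω => N ω A := (Measure.measurable_coe hA).comp hN
    rw [Measure.bind_apply hA hN.aemeasurable]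
    calc ∫⁻ ω, N ω A ∂P = ∫⁻ x, x ∂(P.map fun ω => N ω A) := (lintegral_map measurable_id hm).symm
      _ = ∫⁻ n : ℕ, (n : ℝ≥0∞) ∂(poissonMeasure (ν A).toNNReal) := by
        rw [h.law A hA hfin]
        exact lintegral_map measurable_id .of_discrete
      _ = ν A := by rw [lintegral_natCast_poissonMeasure, ENNReal.coe_toNNReal hfin]
  ext A hA
  have hdisj : Pairwise (Function.onFun Disjoint
      fun n => A ∩ disjointed (spanningSets ν) n) := fun i j hij =>
    (disjoint_disjointed (spanningSets ν) hij).mono Set.inter_subset_right Set.inter_subset_right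
  have hmeas : ∀ n, MeasurableSet (A ∩ disjointed (spanningSets ν) n) := fun n =>
    hA.inter (MeasurableSet.disjointed (measurableSet_spanningSets ν) n)
  have hU : A = ⋃ n, A ∩ disjointed (spanningSets ν) n := by
    rw [← Set.inter_iUnion, iUnion_disjointed, iUnion_spanningSets, Set.inter_univ]
  rw [hU, measure_iUnion hdisj hmeas, measure_iUnion hdisj hmeas]
  refine tsum_congr fun n => fin _ (hmeas n) ?_
  exact ((measure_mono (Set.inter_subset_right.trans (disjointed_subset _ n))).trans_lt
    (measure_spanningSets_lt_top ν n)).ne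

/-- Campbell's formula. -/
theorem IsPoissonProcess.lintegral_sum {Ω : Type*} [MeasurableSpace Ω] {P : Measure Ω}
    {c : Ω → Config} {ν : Measure ℝ} [SigmaFinite ν]
    (h : IsPoissonProcess P (fun ω => (c ω).toMeasure) ν)
    (hc : Measurable c) {f : ℝ → ℝ≥0∞} (hf : Measurable f) :
    ∫⁻ ω, (c ω).sum f ∂P = ∫⁻ x, f x ∂ν := by
  have hN : Measurable fun ω => (c ω).toMeasure := Config.measurable_toMeasure.comp hc
  rw [← h.bind_eq hN, Measure.lintegral_bind hN.aemeasurable hf.aemeasurable]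
  exact lintegral_congr fun ω => ((c ω).lintegral_toMeasure hf).symm

open Classical in
/-- Campbell's formula with an independent parameter. -/
theorem IsPoissonProcess.lintegral_sum_of_indepFun {Ω β : Type*} [MeasurableSpace Ω]
    [MeasurableSpace β] {P : Measure Ω} [IsProbabilityMeasure P]
    {c : Ω → Config} {ν : Measure ℝ} [SigmaFinite ν]
    (h : IsPoissonProcess P (fun ω => (c ω).toMeasure) ν)
    (hc : Measurable c) {Y : Ω → β} (hY : Measurable Y) (hind : IndepFun Y c P)
    {F : β → ℝ → ℝ≥0∞} (hF : Measurable (Function.uncurry F)) :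
    ∫⁻ ω, (c ω).sum (F (Y ω)) ∂P = ∫⁻ ω, ∫⁻ x, F (Y ω) x ∂ν ∂P := by
  have hG : Measurable fun q : β × Config => q.2.sum (F q.1) := by
    refine Measurable.tsum fun k =>
      Measurable.ite (measurable_snd (Config.measurableSet_has k)) ?_ measurable_const
    exact hF.comp (measurable_fst.prodMk
      ((measurable_pi_apply k).comp (measurable_snd.comp measurable_snd)))
  have hprob : IsProbabilityMeasure (P.map c) := Measure.isProbabilityMeasure_map hc.aemeasurable
  calc ∫⁻ ω, (c ω).sum (F (Y ω)) ∂P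
      = ∫⁻ q, q.2.sum (F q.1) ∂(P.map fun ω => (Y ω, c ω)) := (lintegral_map hG (hY.prodMk hc)).symm
    _ = ∫⁻ y, ∫⁻ x, x.sum (F y) ∂(P.map c) ∂(P.map Y) := by
        -- Independence makes the joint law a product, so the parameter can be frozen.
        rw [(indepFun_iff_map_prod_eq_prod_map_map hY.aemeasurable hc.aemeasurable).1 hind,
          lintegral_prod _ hG.aemeasurable]
    _ = ∫⁻ y, ∫⁻ x, F y x ∂ν ∂(P.map Y) := by
        refine lintegral_congr fun y => ?_
        have hm : Measurable fun x : Config => x.sum (F y) := hG.comp measurable_prodMk_left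
        rw [lintegral_map hm hc]
        exact h.lintegral_sum hc (hF.comp measurable_prodMk_left)
    _ = ∫⁻ ω, ∫⁻ x, F (Y ω) x ∂ν ∂P := lintegral_map hF.lintegral_prod_right hY

/-! ### Labels and offspring rates by generation. -/

namespace Label

variable {M : ℕ}

/-- The number of ancestors of an event. -/
def depth : Label M → ℕ
  | .immigrant _ _ => 0
  | .child p _ _ => p.depth + 1

/-- The path of an event from its immigrant ancestor, in reverse order. -/
def path : Label M → List (Fin M × ℕ)
  | .immigrant d k => [(d, k)]
  | .child p d k => (d, k) :: p.path

theorem path_ne_nil (v : Label M) : v.path ≠ [] := by cases v <;> simp [path]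

/-- Serves to make labels countable, so that sums over all events are measurable and commute with
integrals. -/
theorem path_injective : Function.Injective (path : Label M → List (Fin M × ℕ)) := by
  intro v
  induction v with
  | immigrant d k =>
    intro w h
    cases w with
    | immigrant d' k' => simp_all [path]
    | child p d' k' =>
      simp only [path, List.cons.injEq] at h
      exact absurd h.2.symm p.path_ne_nil
  | child p d k ih =>
    intro w h
    cases w with
    | immigrant d' k' =>
      simp only [path, List.cons.injEq] at h
      exact absurd h.2 p.path_ne_nil
    | child q d' k' =>
      simp only [path, List.cons.injEq, Prod.mk.injEq] at h
      rw [ih h.2, h.1.1, h.1.2]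

instance : Countable (Label M) := path_injective.countable

/-- A label is that of an immigrant or that of an offspring. -/
def equivSum : Fin M × ℕ ⊕ Label M × Fin M × ℕ ≃ Label M where
  toFun := Sum.elim (fun q => .immigrant q.1 q.2) (fun q => .child q.1 q.2.1 q.2.2)
  invFun
    | .immigrant d k => .inl (d, k)
    | .child p d k => .inr (p, d, k)
  left_inv x := by rcases x with x | x <;> rfl
  right_inv v := by cases v <;> rfl

/-- The split of events that produces the two sums of the renewal system. -/
theorem tsum_eq (f : Label M → ℝ≥0∞) :
    ∑' v, f v = (∑ d, ∑' k, f (.immigrant d k)) + ∑ d, ∑' p, ∑' k, f (.child p d k) := by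
  rw [← equivSum.tsum_eq, ENNReal.summable.tsum_sum ENNReal.summable, ENNReal.tsum_prod',
    ENNReal.tsum_prod', tsum_fintype]
  congr 1
  simp_rw [ENNReal.tsum_prod']
  rw [ENNReal.tsum_comm, tsum_fintype]
  rfl

end Label

/-- The standing assumptions on the magnitudes and the kernels. -/
structure Params.IsAdmissible {M : ℕ} (θ : Params M) : Prop where
  K_nonneg : ∀ j d, 0 ≤ θ.K j d
  L_nonneg : ∀ j d, 0 ≤ θ.L j d
  measurable_g : ∀ j d, Measurable (θ.g j d)
  measurable_h : ∀ j d, Measurable (θ.h j d)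
  g_nonneg : ∀ j d u, 0 < u → 0 ≤ θ.g j d u
  h_nonneg : ∀ j d u, 0 < u → 0 ≤ θ.h j d u
  integral_g : ∀ j d, ∫ u in Set.Ioi (0 : ℝ), θ.g j d u = 1
  integral_h : ∀ j d, ∫ u in Set.Ioi (0 : ℝ), θ.h j d u = 1

theorem lintegral_ofReal_eq_one {f : ℝ → ℝ} (hf : ∀ u, 0 < u → 0 ≤ f u)
    (h : ∫ u in Set.Ioi (0 : ℝ), f u = 1) : ∫⁻ u in Set.Ioi (0 : ℝ), ENNReal.ofReal (f u) = 1 := by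
  -- The Bochner integral of a non-integrable function is `0`, so the value `1` forces
  -- integrability.
  have hi : Integrable f (volume.restrict (Set.Ioi 0)) := by
    by_contra hni
    rw [integral_undef hni] at h
    exact zero_ne_one h
  rw [← ofReal_integral_eq_lintegral_ofReal hi, h, ENNReal.ofReal_one]
  filter_upwards [ae_restrict_mem measurableSet_Ioi] with u hu using hf u hu

/-- The matrix of mean offspring numbers of the events of generation `n`. -/
def Params.genCoef {M : ℕ} (θ : Params M) (n : ℕ) : Matrix (Fin M) (Fin M) ℝ :=
  if n = 0 then θ.K else θ.L

/-- The normalised kernels of the events of generation `n`. -/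
def Params.genKernel {M : ℕ} (θ : Params M) (n : ℕ) : Fin M → Fin M → ℝ → ℝ :=
  if n = 0 then θ.g else θ.h

namespace Params

variable {M : ℕ} {θ : Params M}

theorem rate_eq (v : Label M) (d : Fin M) (u : ℝ) :
    θ.rate v d u = θ.genCoef v.depth v.dim d * θ.genKernel v.depth v.dim d u := by
  cases v <;> simp [rate, genCoef, genKernel, Label.depth, Label.dim]

theorem IsAdmissible.genCoef_nonneg (hθ : θ.IsAdmissible) (n : ℕ) (j d : Fin M) :
    0 ≤ θ.genCoef n j d := by
  rw [genCoef]
  split_ifs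
  exacts [hθ.K_nonneg j d, hθ.L_nonneg j d]

theorem IsAdmissible.measurable_genKernel (hθ : θ.IsAdmissible) (n : ℕ) (j d : Fin M) :
    Measurable (θ.genKernel n j d) := by
  rw [genKernel]
  split_ifs
  exacts [hθ.measurable_g j d, hθ.measurable_h j d]

theorem IsAdmissible.lintegral_genKernel (hθ : θ.IsAdmissible) (n : ℕ) (j d : Fin M) :
    ∫⁻ u in Set.Ioi (0 : ℝ), ENNReal.ofReal (θ.genKernel n j d u) = 1 := by
  rw [genKernel]
  split_ifs
  exacts [lintegral_ofReal_eq_one (hθ.g_nonneg j d) (hθ.integral_g j d),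
    lintegral_ofReal_eq_one (hθ.h_nonneg j d) (hθ.integral_h j d)]

theorem IsAdmissible.measurable_rate (hθ : θ.IsAdmissible) (v : Label M) (d : Fin M) :
    Measurable (θ.rate v d) := by
  have : θ.rate v d = fun u => θ.genCoef v.depth v.dim d * θ.genKernel v.depth v.dim d u :=
    funext fun u => rate_eq v d u
  rw [this]
  exact (hθ.measurable_genKernel _ _ _).const_mul _

end Params

/-! ### Generations, measurability and independence. -/

namespace ClusterSystem

variable {M : ℕ} {Ω : Type*} {X : ClusterSystem M Ω}

/-- The family of all configurations of the cluster representation. -/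
def family (X : ClusterSystem M Ω) (i : Fin M ⊕ (Label M × Fin M)) : Ω → Config :=
  Sum.elim X.imm (fun q => X.off q.1 q.2) i

/-- The configurations that determine the events of the generations up to `n`. -/
def pastIndices (M n : ℕ) : Set (Fin M ⊕ (Label M × Fin M)) :=
  {i | ∀ q, i = Sum.inr q → q.1.depth < n}

/-- The σ-algebra of the generations up to `n`. -/
abbrev past (X : ClusterSystem M Ω) (n : ℕ) : MeasurableSpace Ω :=
  ⨆ i ∈ pastIndices M n, MeasurableSpace.comap (X.family i) inferInstance

theorem past_mono (X : ClusterSystem M Ω) {m n : ℕ} (h : m ≤ n) : X.past m ≤ X.past n :=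
  biSup_mono fun _ hi q hq => (hi q hq).trans_le h

theorem measurable_imm_past (X : ClusterSystem M Ω) (d : Fin M) (n : ℕ) :
    Measurable[X.past n] (X.imm d) := by
  have h : (Sum.inl d : Fin M ⊕ (Label M × Fin M)) ∈ pastIndices M n := fun q hq => by cases hq
  exact measurable_iff_comap_le.2
    (le_biSup (fun i => MeasurableSpace.comap (X.family i) inferInstance) h)

theorem measurable_off_past (X : ClusterSystem M Ω) (p : Label M) (d : Fin M) {n : ℕ}
    (hn : p.depth < n) : Measurable[X.past n] (X.off p d) := by
  have h : (Sum.inr (p, d) : Fin M ⊕ (Label M × Fin M)) ∈ pastIndices M n := fun q hq => by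
    cases hq
    exact hn
  exact measurable_iff_comap_le.2
    (le_biSup (fun i => MeasurableSpace.comap (X.family i) inferInstance) h)

/-- Measurability for `past v.depth`, and not just for the ambient σ-algebra, is what gives
independence from the offspring of `v`. -/
theorem measurableSet_occurs_past (X : ClusterSystem M Ω) (v : Label M) :
    MeasurableSet[X.past v.depth] {ω | X.Occurs ω v} := by
  induction v with
  | immigrant d k => exact X.measurable_imm_past d _ (Config.measurableSet_has k)
  | child p d k ih =>
    exact MeasurableSet.inter (X.past_mono (Nat.le_succ _) _ ih)
      (X.measurable_off_past p d (Nat.lt_succ_self _) (Config.measurableSet_has k))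

theorem measurable_time_past (X : ClusterSystem M Ω) (v : Label M) :
    Measurable[X.past v.depth] fun ω => X.time ω v := by
  induction v with
  | immigrant d k =>
    exact (measurable_pi_apply k).comp (measurable_snd.comp (X.measurable_imm_past d _))
  | child p d k ih =>
    exact Measurable.add (ih.mono (X.past_mono (Nat.le_succ _)) le_rfl)
      ((measurable_pi_apply k).comp
        (measurable_snd.comp (X.measurable_off_past p d (Nat.lt_succ_self _))))

theorem measurableSet_inCluster_past (X : ClusterSystem M Ω) (v w : Label M) :
    MeasurableSet[X.past w.depth] {ω | X.InCluster ω v w} := by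
  induction w with
  | immigrant d k => exact MeasurableSet.const _
  | child p d k ih =>
    exact (MeasurableSet.const _).union (MeasurableSet.inter (X.past_mono (Nat.le_succ _) _ ih)
      (X.measurable_off_past p d (Nat.lt_succ_self _) (Config.measurableSet_has k)))

theorem inCluster_eq_or_depth_lt {ω : Ω} {v w : Label M} (h : X.InCluster ω v w) :
    w = v ∨ v.depth < w.depth := by
  induction w with
  | immigrant d k => exact Or.inl h
  | child p d k ih =>
    rcases h with h | h
    · exact Or.inl h
    · refine Or.inr ?_
      rcases ih h.1 with rfl | h'
      · exact Nat.lt_succ_self _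
      · exact h'.trans (Nat.lt_succ_self _)

variable [MeasurableSpace Ω] {θ : Params M} {P : Measure Ω}

namespace IsAncestorHawkes

theorem measurable_family (hX : X.IsAncestorHawkes θ P) (i : Fin M ⊕ (Label M × Fin M)) :
    Measurable (X.family i) := by
  rcases i with d | q
  exacts [hX.measurable_imm d, hX.measurable_off q.1 q.2]

theorem past_le (hX : X.IsAncestorHawkes θ P) (n : ℕ) : X.past n ≤ ‹MeasurableSpace Ω› :=
  iSup₂_le fun i _ => (hX.measurable_family i).comap_le

theorem measurableSet_occurs (hX : X.IsAncestorHawkes θ P) (v : Label M) :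
    MeasurableSet {ω | X.Occurs ω v} := hX.past_le _ _ (X.measurableSet_occurs_past v)

theorem measurable_time (hX : X.IsAncestorHawkes θ P) (v : Label M) :
    Measurable fun ω => X.time ω v := (X.measurable_time_past v).mono (hX.past_le _) le_rfl

theorem measurableSet_inCluster (hX : X.IsAncestorHawkes θ P) (v w : Label M) :
    MeasurableSet {ω | X.InCluster ω v w} := hX.past_le _ _ (X.measurableSet_inCluster_past v w)

/-- The offspring of an event is independent of its generation and the previous ones. -/
theorem indepFun_off (hX : X.IsAncestorHawkes θ P) (p : Label M) (d : Fin M)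
    {β : Type*} [MeasurableSpace β] {Y : Ω → β} (hY : Measurable[X.past p.depth] Y) :
    IndepFun Y (X.off p d) P := by
  rw [IndepFun_iff_Indep]
  -- The bound on the depth in `pastIndices` is strict, so the offspring of `p` itself are left out.
  have hdisj : Disjoint (pastIndices M p.depth) {Sum.inr (p, d)} := by
    rw [Set.disjoint_singleton_right]
    intro h
    exact lt_irrefl _ (h _ rfl)
  have h := indep_iSup_of_disjoint (fun i => (hX.measurable_family i).comap_le)
    hX.indep.iIndep hdisj
  refine indep_of_indep_of_le_left (indep_of_indep_of_le_right h ?_) (measurable_iff_comap_le.1 hY)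
  rw [iSup_singleton]
  exact le_rfl

/-- Campbell's formula for the delays after `p`, whose time and the event `E` are independent of
them. -/
theorem lintegral_off (hX : X.IsAncestorHawkes θ P) (hθ : θ.IsAdmissible)
    [IsProbabilityMeasure P] (p : Label M) (d : Fin M)
    {E : Set Ω} (hE : MeasurableSet[X.past p.depth] E) {f : ℝ → ℝ≥0∞} (hf : Measurable f) :
    ∑' k, ∫⁻ ω in E ∩ {ω | (X.off p d ω).Has k}, f (X.time ω (.child p d k)) ∂P =
      ∫⁻ ω in E, (∫⁻ u in Set.Ioi (0 : ℝ),
        ENNReal.ofReal (θ.rate p d u) * f (X.time ω p + u)) ∂P := by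
  classical
  have hE' : MeasurableSet E := hX.past_le _ _ hE
  have hH : ∀ k, MeasurableSet {ω | (X.off p d ω).Has k} := fun k =>
    hX.measurable_off p d (Config.measurableSet_has k)
  have hmt : ∀ k, Measurable fun ω => f (X.time ω (.child p d k)) := fun k =>
    hf.comp (hX.measurable_time _)
  -- The indicator of `E` joins the parameter, which turns the restricted integral into a full one.
  let Y : Ω → ℝ≥0∞ × ℝ := fun ω => (E.indicator (fun _ => 1) ω, X.time ω p)
  let F : ℝ≥0∞ × ℝ → ℝ → ℝ≥0∞ := fun y u => y.1 * f (y.2 + u)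
  have hY : Measurable[X.past p.depth] Y :=
    Measurable.prodMk ((@measurable_const _ _ _ (X.past p.depth) 1).indicator hE) (X.measurable_time_past p)
  have hF : Measurable (Function.uncurry F) := by
    refine (measurable_fst.comp measurable_fst).mul (hf.comp ?_)
    exact (measurable_snd.comp measurable_fst).add measurable_snd
  have key := (hX.poisson_off p d).lintegral_sum_of_indepFun (hX.measurable_off p d)
    (hY.mono (hX.past_le _) le_rfl) (hX.indepFun_off p d hY) hF
  calc ∑' k, ∫⁻ ω in E ∩ {ω | (X.off p d ω).Has k}, f (X.time ω (.child p d k)) ∂P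
      = ∑' k, ∫⁻ ω, (if (X.off p d ω).Has k then F (Y ω) ((X.off p d ω).2 k) else 0) ∂P := by
        refine tsum_congr fun k => ?_
        rw [← lintegral_indicator (hE'.inter (hH k))]
        refine lintegral_congr fun ω => ?_
        by_cases h1 : ω ∈ E <;> by_cases h2 : (X.off p d ω).Has k <;>
          simp [h1, h2, F, Y, time]
    _ = ∫⁻ ω, (X.off p d ω).sum (F (Y ω)) ∂P := by
        rw [← lintegral_tsum]
        · rfl
        · intro k
          refine (Measurable.ite (hH k) (hF.comp ((hY.mono (hX.past_le _) le_rfl).prodMk ?_))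
            measurable_const).aemeasurable
          exact (measurable_pi_apply k).comp (measurable_snd.comp (hX.measurable_off p d))
    _ = ∫⁻ ω in E, (∫⁻ u in Set.Ioi (0 : ℝ),
        ENNReal.ofReal (θ.rate p d u) * f (X.time ω p + u)) ∂P := by
        rw [key, ← lintegral_indicator hE']
        refine lintegral_congr fun ω => ?_
        have hfu : Measurable fun u => f (X.time ω p + u) := hf.comp (measurable_const_add _)
        simp only [F, Y]
        rw [lintegral_const_mul _ hfu, lintegral_withDensity_eq_lintegral_mul _
          (hθ.measurable_rate p d).ennreal_ofReal hfu]
        by_cases h1 : ω ∈ E <;> simp [h1]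

end IsAncestorHawkes

end ClusterSystem

-- Non-negative matrices of spectral radius less than one.

-- Gelfand's formula: for some `r < 1` the norm of the `n`-th power is eventually at most `r ^ n`,
-- and the chosen norm dominates each entry.
attribute [local instance] Matrix.linftyOpNormedAddCommGroup Matrix.linftyOpNormedRing
  Matrix.linftyOpNormedAlgebra in
theorem summable_pow_apply_of_spectralRadius_lt_one {M : ℕ} {A : Matrix (Fin M) (Fin M) ℝ}
    (hρ : spectralRadius ℂ (A.map (fun x : ℝ => (x : ℂ))) < 1) (i j : Fin M) :
    Summable fun n : ℕ => (A ^ n) i j := by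
  set B := A.map (fun x : ℝ => (x : ℂ)) with hB
  have hpow : ∀ n, B ^ n = (A ^ n).map (fun x : ℝ => (x : ℂ)) := fun n =>
    (map_pow (Complex.ofRealHom.mapMatrix : Matrix (Fin M) (Fin M) ℝ →+* _) A n).symm
  obtain ⟨r, hr, hr1⟩ := ENNReal.lt_iff_exists_nnreal_btwn.1 hρ
  have hr1' : r < 1 := by exact_mod_cast hr1
  have hev := Filter.eventually_lt_of_limsup_lt
    ((spectrum.limsup_pow_nnnorm_pow_one_div_le_spectralRadius B).trans_lt hr)
  refine Summable.of_norm_bounded_eventually_nat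
    (summable_geometric_of_lt_one r.coe_nonneg hr1') ?_
  filter_upwards [hev, Filter.eventually_gt_atTop 0] with n hn hn0
  have hn' : (n : ℝ) ≠ 0 := by positivity
  have h1 : (‖B ^ n‖₊ : ℝ≥0∞) ≤ (r : ℝ≥0∞) ^ n := by
    have h2 := ENNReal.rpow_le_rpow hn.le (Nat.cast_nonneg n : (0 : ℝ) ≤ n)
    rwa [← ENNReal.rpow_mul, one_div_mul_cancel hn', ENNReal.rpow_one, ENNReal.rpow_natCast] at h2
  have h3 : ‖B ^ n‖₊ ≤ r ^ n := by exact_mod_cast h1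
  have h4 : ‖(B ^ n) i j‖₊ ≤ ‖B ^ n‖₊ := by
    rw [Matrix.linfty_opNNNorm_def]
    refine le_trans ?_ (Finset.le_sup (f := fun i => ∑ j, ‖(B ^ n) i j‖₊) (Finset.mem_univ i))
    exact Finset.single_le_sum (f := fun j => ‖(B ^ n) i j‖₊) (fun _ _ => zero_le) (Finset.mem_univ j)
  have h5 : ‖(B ^ n) i j‖ = ‖(A ^ n) i j‖ := by
    rw [hpow]
    simp
  rw [← h5]
  exact_mod_cast h4.trans h3

theorem pow_apply_nonneg {M : ℕ} {A : Matrix (Fin M) (Fin M) ℝ} (hA : ∀ i j, 0 ≤ A i j) (n : ℕ)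
    (i j : Fin M) : 0 ≤ (A ^ n) i j := by
  induction n generalizing j with
  | zero =>
    rw [pow_zero, Matrix.one_apply]
    split_ifs <;> norm_num
  | succ n ih =>
    rw [pow_succ, Matrix.mul_apply]
    exact Finset.sum_nonneg fun k _ => mul_nonneg (ih k) (hA k j)

theorem le_sum_mul_pow {M : ℕ} {A : Matrix (Fin M) (Fin M) ℝ} (hA : ∀ i j, 0 ≤ A i j)
    {B : ℕ → Fin M → ℝ≥0∞} {m : ℕ}
    (hstep : ∀ n ≥ m, ∀ d, B (n + 1) d ≤ ∑ j, ENNReal.ofReal (A j d) * B n j) (n : ℕ) (d : Fin M) :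
    B (m + n) d ≤ ∑ i, B m i * ENNReal.ofReal ((A ^ n) i d) := by
  induction n generalizing d with
  | zero =>
    refine le_trans (le_of_eq ?_) (Finset.single_le_sum (f := fun i =>
      B m i * ENNReal.ofReal ((A ^ 0) i d)) (fun _ _ => zero_le) (Finset.mem_univ d))
    simp
  | succ n ih =>
    calc B (m + (n + 1)) d ≤ ∑ j, ENNReal.ofReal (A j d) * B (m + n) j :=
          hstep (m + n) (Nat.le_add_right _ _) d
      _ ≤ ∑ j, ENNReal.ofReal (A j d) * ∑ i, B m i * ENNReal.ofReal ((A ^ n) i j) := by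
          gcongr with j
          exact ih j
      _ = ∑ i, B m i * ENNReal.ofReal ((A ^ (n + 1)) i d) := by
          simp_rw [Finset.mul_sum]
          rw [Finset.sum_comm]
          refine Finset.sum_congr rfl fun i _ => ?_
          rw [pow_succ, Matrix.mul_apply, ENNReal.ofReal_sum_of_nonneg
            fun k _ => mul_nonneg (pow_apply_nonneg hA n i k) (hA k d), Finset.mul_sum]
          refine Finset.sum_congr rfl fun j _ => ?_
          rw [ENNReal.ofReal_mul (pow_apply_nonneg hA n i j)]
          ring

/-- A sequence of vectors that is eventually dominated by its image under a non-negative matrix of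
spectral radius less than one is summable. -/
theorem tsum_lt_top_of_le_sum_mul {M : ℕ} {A : Matrix (Fin M) (Fin M) ℝ} (hA : ∀ i j, 0 ≤ A i j)
    (hρ : spectralRadius ℂ (A.map (fun x : ℝ => (x : ℂ))) < 1)
    {B : ℕ → Fin M → ℝ≥0∞} {m : ℕ} (hfin : ∀ n ≤ m, ∀ d, B n d < ∞)
    (hstep : ∀ n ≥ m, ∀ d, B (n + 1) d ≤ ∑ j, ENNReal.ofReal (A j d) * B n j) (d : Fin M) :
    ∑' n, B n d < ∞ := by
  have hpow := le_sum_mul_pow hA hstep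
  rw [← Summable.sum_add_tsum_nat_add' (f := fun n => B n d) (k := m) ENNReal.summable]
  refine ENNReal.add_lt_top.2 ⟨ENNReal.sum_lt_top.2 fun n hn =>
    hfin n (Finset.mem_range.1 hn).le d, ?_⟩
  calc ∑' n, B (n + m) d ≤ ∑' n, ∑ i, B m i * ENNReal.ofReal ((A ^ n) i d) :=
        ENNReal.tsum_le_tsum fun n => by
          rw [add_comm]
          exact hpow n d
    _ = ∑ i, B m i * ∑' n, ENNReal.ofReal ((A ^ n) i d) := by
        rw [Summable.tsum_finsetSum fun _ _ => ENNReal.summable]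
        simp_rw [ENNReal.tsum_mul_left]
    _ < ∞ := ENNReal.sum_lt_top.2 fun i _ => ENNReal.mul_lt_top (hfin m le_rfl i)
        (summable_pow_apply_of_spectralRadius_lt_one hρ i d).tsum_ofReal_lt_top

/-! ### Means by generation and subcriticality. -/

namespace ClusterSystem

variable {M : ℕ} {Ω : Type*} {X : ClusterSystem M Ω} [MeasurableSpace Ω] {θ : Params M}
  {P : Measure Ω}

theorem lintegral_encard {S : Label M → Set Ω} (hS : ∀ w, MeasurableSet (S w)) :
    ∫⁻ ω, (({w | ω ∈ S w}.encard : ℕ∞) : ℝ≥0∞) ∂P = ∑' w, P (S w) := by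
  calc ∫⁻ ω, (({w | ω ∈ S w}.encard : ℕ∞) : ℝ≥0∞) ∂P
      = ∫⁻ ω, ∑' w, (S w).indicator 1 ω ∂P := by
        refine lintegral_congr fun ω => ?_
        rw [← ENNReal.tsum_set_one, tsum_subtype {w | ω ∈ S w} (fun _ => (1 : ℝ≥0∞))]
        rfl
    _ = ∑' w, P (S w) := by
        rw [lintegral_tsum fun w => (measurable_one.indicator (hS w)).aemeasurable]
        exact tsum_congr fun w => lintegral_indicator_one (hS w)

/-- The mean of the sum of `f` over the times of the events of generation `n` in dimension `d`,
where only those events `w` count for which `A w` happens. -/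
def genMean (X : ClusterSystem M Ω) (P : Measure Ω) (A : Label M → Set Ω) (n : ℕ) (d : Fin M)
    (f : ℝ → ℝ≥0∞) : ℝ≥0∞ :=
  ∑' w : Label M, if w.depth = n ∧ w.dim = d then ∫⁻ ω in A w, f (X.time ω w) ∂P else 0

theorem tsum_genMean (A : Label M → Set Ω) (d : Fin M) (f : ℝ → ℝ≥0∞) :
    ∑' n, X.genMean P A n d f =
      ∑' w : Label M, if w.dim = d then ∫⁻ ω in A w, f (X.time ω w) ∂P else 0 := by
  simp only [genMean]
  rw [ENNReal.tsum_comm]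
  refine tsum_congr fun w => ?_
  rw [tsum_eq_single w.depth fun n hn => if_neg fun h => hn h.1.symm]
  simp

namespace IsAncestorHawkes

/-- A child's time is its parent's time plus a delay, so averaging over the delay turns a sum over
children into one over parents with `f` translated. The inclusion `hsub` covers both occurrence and
cluster membership as `A`. -/
theorem genMean_succ_le (hX : X.IsAncestorHawkes θ P) (hθ : θ.IsAdmissible)
    [IsProbabilityMeasure P] {A : Label M → Set Ω}
    (hA : ∀ p : Label M, MeasurableSet[X.past p.depth] (A p)) {n : ℕ}
    (hsub : ∀ p d k, p.depth = n → A (.child p d k) ⊆ A p ∩ {ω | (X.off p d ω).Has k})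
    (d : Fin M) {f : ℝ → ℝ≥0∞} (hf : Measurable f) :
    X.genMean P A (n + 1) d f ≤ ∑ j, ENNReal.ofReal (θ.genCoef n j d) *
      ∫⁻ u in Set.Ioi (0 : ℝ), ENNReal.ofReal (θ.genKernel n j d u) *
        X.genMean P A n j (fun t => f (t + u)) := by
  have hmeas : ∀ p, Measurable (Function.uncurry fun (u : ℝ) ω => f (X.time ω p + u)) := fun p =>
    hf.comp (((hX.measurable_time p).comp measurable_snd).add measurable_fst)
  have hin : ∀ p, Measurable fun u : ℝ => ∫⁻ ω in A p, f (X.time ω p + u) ∂P := fun p =>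
    (hmeas p).lintegral_prod_right
  have hterm : ∀ p : Label M, p.depth = n →
      ∑' k, ∫⁻ ω in A (.child p d k), f (X.time ω (.child p d k)) ∂P ≤
        ENNReal.ofReal (θ.genCoef n p.dim d) * ∫⁻ u in Set.Ioi (0 : ℝ),
          ENNReal.ofReal (θ.genKernel n p.dim d u) * ∫⁻ ω in A p, f (X.time ω p + u) ∂P := by
    intro p hp
    calc ∑' k, ∫⁻ ω in A (.child p d k), f (X.time ω (.child p d k)) ∂P
        ≤ ∑' k, ∫⁻ ω in A p ∩ {ω | (X.off p d ω).Has k}, f (X.time ω (.child p d k)) ∂P :=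
          ENNReal.tsum_le_tsum fun k => lintegral_mono_set (hsub p d k hp)
      _ = ∫⁻ ω in A p, (∫⁻ u in Set.Ioi (0 : ℝ),
            ENNReal.ofReal (θ.rate p d u) * f (X.time ω p + u)) ∂P := hX.lintegral_off hθ p d (hA p) hf
      _ = ∫⁻ u in Set.Ioi (0 : ℝ), (∫⁻ ω in A p,
            ENNReal.ofReal (θ.rate p d u) * f (X.time ω p + u) ∂P) := by
          refine lintegral_lintegral_swap (Measurable.aemeasurable ?_)
          exact ((hθ.measurable_rate p d).ennreal_ofReal.comp measurable_snd).mul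
            ((hmeas p).comp measurable_swap)
      _ = _ := by
          rw [← lintegral_const_mul' _ _ ENNReal.ofReal_ne_top]
          refine lintegral_congr fun u => ?_
          rw [lintegral_const_mul' _ _ ENNReal.ofReal_ne_top, Params.rate_eq, hp,
            ENNReal.ofReal_mul (hθ.genCoef_nonneg _ _ _), mul_assoc]
  calc X.genMean P A (n + 1) d f
      = ∑' p : Label M, if p.depth = n then
          ∑' k, ∫⁻ ω in A (.child p d k), f (X.time ω (.child p d k)) ∂P else 0 := by
        rw [genMean, Label.tsum_eq]
        simp only [Label.depth, Label.dim, Nat.add_right_cancel_iff]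
        rw [Finset.sum_eq_zero, zero_add, Finset.sum_eq_single d]
        · refine tsum_congr fun p => ?_
          by_cases hp : p.depth = n <;> simp [hp]
        · intro d' _ hd
          simp [hd]
        · simp
        · simp
    _ ≤ ∑' p : Label M, if p.depth = n then
        ENNReal.ofReal (θ.genCoef n p.dim d) * ∫⁻ u in Set.Ioi (0 : ℝ),
          ENNReal.ofReal (θ.genKernel n p.dim d u) * ∫⁻ ω in A p, f (X.time ω p + u) ∂P else 0 := by
        refine ENNReal.tsum_le_tsum fun p => ?_
        split_ifs with hp
        exacts [hterm p hp, le_rfl]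
    -- The redundant sum over `j` frees coefficient and kernel from `p`, so that the sum over `p`
    -- can move inside.
    _ = ∑' p : Label M, ∑ j, ENNReal.ofReal (θ.genCoef n j d) * ∫⁻ u in Set.Ioi (0 : ℝ),
          ENNReal.ofReal (θ.genKernel n j d u) *
            (if p.depth = n ∧ p.dim = j then ∫⁻ ω in A p, f (X.time ω p + u) ∂P else 0) := by
        refine tsum_congr fun p => ?_
        rw [Finset.sum_eq_single p.dim]
        · by_cases hp : p.depth = n <;> simp [hp]
        · intro j _ hj
          simp [hj.symm]
        · simp
    _ = _ := by
        rw [Summable.tsum_finsetSum fun _ _ => ENNReal.summable]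
        refine Finset.sum_congr rfl fun j _ => ?_
        rw [ENNReal.tsum_mul_left, ← lintegral_tsum]
        · simp_rw [ENNReal.tsum_mul_left]
          rfl
        · intro p
          refine ((hθ.measurable_genKernel n j d).ennreal_ofReal.mul ?_).aemeasurable
          split_ifs
          exacts [hin p, measurable_const]

/-- The means over all generations of a translation invariant class of test functions are bounded
if they are so for the first generations. -/
theorem tsum_iSup_genMean_lt_top (hX : X.IsAncestorHawkes θ P) (hθ : θ.IsAdmissible)
    (hρ : spectralRadius ℂ (θ.L.map (fun x : ℝ => (x : ℂ))) < 1)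
    [IsProbabilityMeasure P] {A : Label M → Set Ω}
    (hA : ∀ p : Label M, MeasurableSet[X.past p.depth] (A p)) {m : ℕ}
    (hsub : ∀ p d k, m ≤ p.depth → A (.child p d k) ⊆ A p ∩ {ω | (X.off p d ω).Has k})
    {Φ : Set (ℝ → ℝ≥0∞)} (hΦ : ∀ f ∈ Φ, Measurable f)
    (hΦ_add : ∀ f ∈ Φ, ∀ u : ℝ, 0 < u → (fun t => f (t + u)) ∈ Φ)
    (hfin : ∀ n ≤ m, ∀ d, ⨆ f ∈ Φ, X.genMean P A n d f < ∞) (d : Fin M) :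
    ∑' n, ⨆ f ∈ Φ, X.genMean P A n d f < ∞ := by
  -- The supremum over `Φ` absorbs the translation by `u`; the kernel then integrates to one.
  have hstep : ∀ n ≥ m, ∀ d, ⨆ f ∈ Φ, X.genMean P A (n + 1) d f ≤
      ∑ j, ENNReal.ofReal (θ.genCoef n j d) * ⨆ f ∈ Φ, X.genMean P A n j f := by
    intro n hn d
    refine iSup₂_le fun f hf => (hX.genMean_succ_le hθ hA
      (fun p d k hp => hsub p d k (hn.trans hp.ge)) d (hΦ f hf)).trans ?_
    gcongr with j
    calc ∫⁻ u in Set.Ioi (0 : ℝ), ENNReal.ofReal (θ.genKernel n j d u) *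
          X.genMean P A n j (fun t => f (t + u))
        ≤ ∫⁻ u in Set.Ioi (0 : ℝ), ENNReal.ofReal (θ.genKernel n j d u) *
          ⨆ f ∈ Φ, X.genMean P A n j f := by
          refine setLIntegral_mono' measurableSet_Ioi fun u hu => ?_
          gcongr
          exact le_iSup₂ (f := fun f (_ : f ∈ Φ) => X.genMean P A n j f) _ (hΦ_add f hf u hu)
      _ = ⨆ f ∈ Φ, X.genMean P A n j f := by
          rw [lintegral_mul_const _ (hθ.measurable_genKernel n j d).ennreal_ofReal,
            hθ.lintegral_genKernel, one_mul]
  -- Starting at `m + 1` ensures that the matrix is `L`: for `m = 0` the step out of generation `0`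
  -- uses `K`.
  refine tsum_lt_top_of_le_sum_mul (B := fun n d => ⨆ f ∈ Φ, X.genMean P A n d f) (m := m + 1)
    hθ.L_nonneg hρ ?_ ?_ d
  · intro n hn d
    rcases Nat.lt_or_ge m n with h | h
    · obtain rfl : n = m + 1 := le_antisymm hn h
      refine (hstep m le_rfl d).trans_lt (ENNReal.sum_lt_top.2 fun j _ => ?_)
      exact ENNReal.mul_lt_top ENNReal.ofReal_lt_top (hfin m le_rfl j)
    · exact hfin n h d
  · intro n hn d
    have h := hstep n ((Nat.le_succ m).trans hn) d
    rwa [Params.genCoef, if_neg (Nat.ne_of_gt ((Nat.succ_pos m).trans_le hn))] at h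

theorem lintegral_clusterSize_lt_top (hX : X.IsAncestorHawkes θ P) (hθ : θ.IsAdmissible)
    (hρ : spectralRadius ℂ (θ.L.map (fun x : ℝ => (x : ℂ))) < 1)
    [IsProbabilityMeasure P] (v : Label M) : ∫⁻ ω, X.clusterSize v ω ∂P < ∞ := by
  have hsum : ∫⁻ ω, X.clusterSize v ω ∂P =
      ∑ d, ∑' n, X.genMean P (fun w => {ω | X.InCluster ω v w}) n d 1 := by
    refine (lintegral_encard fun w => hX.measurableSet_inCluster v w).trans ?_
    simp_rw [tsum_genMean]
    rw [← Summable.tsum_finsetSum fun _ _ => ENNReal.summable]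
    refine tsum_congr fun w => ?_
    simp
  rw [hsum]
  refine ENNReal.sum_lt_top.2 fun d _ => ?_
  have h := hX.tsum_iSup_genMean_lt_top hθ hρ (A := fun w => {ω | X.InCluster ω v w})
    (X.measurableSet_inCluster_past v) (m := v.depth) (Φ := {1}) ?_ ?_ ?_ ?_ d
  · simpa using h
  · intro p d k hp ω hω
    -- A child of an event at least as deep as `v` cannot be `v`.
    refine Or.resolve_left hω ?_
    rintro rfl
    exact absurd hp (Nat.not_succ_le_self _)
  · rintro f rfl
    exact measurable_one
  · rintro f rfl u -
    rfl
  · intro n hn d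
    -- Other members lie strictly deeper than `v`, so up to its depth only `v` can count.
    have hle : X.genMean P (fun w => {ω | X.InCluster ω v w}) n d 1 ≤ 1 := by
      rw [genMean, tsum_eq_single v]
      · split_ifs
        · simpa using prob_le_one
        · exact zero_le_one
      · intro w hw
        split_ifs with h
        · have : {ω | X.InCluster ω v w} = ∅ := by
            refine Set.eq_empty_iff_forall_notMem.2 fun ω hω => ?_
            rcases inCluster_eq_or_depth_lt hω with h' | h'
            · exact hw h'
            · exact absurd (h.1 ▸ h') (not_lt.2 hn)
          simp [this]
        · rfl
    simpa using hle.trans_lt ENNReal.one_lt_top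

end IsAncestorHawkes

end ClusterSystem

/-! ### Mean intensities, renewal system and expected counts. -/

/-- The rate of the direct offspring in dimension `d` at a time `x` after the event, which vanishes
if `x` is not positive. -/
def Params.influence {M : ℕ} (θ : Params M) (v : Label M) (d : Fin M) : ℝ → ℝ≥0∞ :=
  (Set.Ioi 0).indicator fun u => ENNReal.ofReal (θ.rate v d u)

theorem Params.IsAdmissible.measurable_influence {M : ℕ} {θ : Params M} (hθ : θ.IsAdmissible)
    (v : Label M) (d : Fin M) : Measurable (θ.influence v d) :=
  (hθ.measurable_rate v d).ennreal_ofReal.indicator measurableSet_Ioi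

theorem lintegral_indicator_one_mul {A : Set ℝ} (hA : MeasurableSet A) (φ : ℝ → ℝ≥0∞) :
    ∫⁻ s, A.indicator 1 s * φ s = ∫⁻ s in A, φ s := by
  rw [← lintegral_indicator hA]
  refine lintegral_congr fun s => ?_
  by_cases hs : s ∈ A <;> simp [hs]

theorem lintegral_indicator_sub_mul {c : ℝ} (hc : 0 ≤ c) (k : ℝ → ℝ) (φ : ℝ → ℝ≥0∞) (t : ℝ) :
    ∫⁻ s, (Set.Ioi 0).indicator (fun u => ENNReal.ofReal (c * k u)) (t - s) * φ s =
      ENNReal.ofReal c * ∫⁻ u in Set.Ioi (0 : ℝ), ENNReal.ofReal (k u) * φ (t - u) := by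
  rw [← lintegral_sub_left_eq_self _ t, ← lintegral_const_mul' _ _ ENNReal.ofReal_ne_top,
    ← lintegral_indicator measurableSet_Ioi]
  refine lintegral_congr fun u => ?_
  rw [sub_sub_cancel]
  by_cases hu : u ∈ Set.Ioi (0 : ℝ)
  · simp [hu, ENNReal.ofReal_mul hc, mul_assoc]
  · simp [hu]

theorem lintegral_Ioi_eq_lintegral_influence {M : ℕ} {θ : Params M} (v : Label M) (d : Fin M)
    (f : ℝ → ℝ≥0∞) (t : ℝ) :
    ∫⁻ u in Set.Ioi (0 : ℝ), ENNReal.ofReal (θ.rate v d u) * f (t + u) =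
      ∫⁻ s, f s * θ.influence v d (s - t) := by
  rw [← lintegral_add_left_eq_self (fun s => f s * θ.influence v d (s - t)) t,
    ← lintegral_indicator measurableSet_Ioi]
  refine lintegral_congr fun u => ?_
  rw [add_sub_cancel_left, Params.influence]
  by_cases hu : u ∈ Set.Ioi (0 : ℝ) <;> simp [hu, mul_comm]

namespace ClusterSystem

variable {M : ℕ} {Ω : Type*} {X : ClusterSystem M Ω} [MeasurableSpace Ω] {θ : Params M}
  {P : Measure Ω}

-- The index set no longer depends on `ω`, so expectations pass through the sum; the condition that
-- `v` precedes `t` is absorbed by `influence`.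
omit [MeasurableSpace Ω] in
theorem triggeredIntensity_eq (X : ClusterSystem M Ω) (θ : Params M) (d : Fin M) (t : ℝ) (ω : Ω) :
    X.triggeredIntensity θ d t ω =
      ∑' v, {ω | X.Occurs ω v}.indicator (fun ω => θ.influence v d (t - X.time ω v)) ω := by
  classical
  refine (tsum_subtype {v | X.Occurs ω v ∧ X.time ω v < t}
    (fun v => ENNReal.ofReal (θ.rate v d (t - X.time ω v)))).trans (tsum_congr fun v => ?_)
  simp only [Set.indicator_apply, Params.influence, Set.mem_ofPred_eq, Set.mem_Ioi, sub_pos]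
  rw [ite_and]

theorem meanIntensity_eq [IsProbabilityMeasure P] (d : Fin M) (t : ℝ) :
    X.meanIntensity θ P d t = ENNReal.ofReal (θ.mu d t) + X.meanTriggered θ P d t := by
  simp only [meanIntensity, intensity]
  rw [lintegral_add_left measurable_const]
  simp [meanTriggered]

namespace IsAncestorHawkes

theorem measurable_influence_time (hX : X.IsAncestorHawkes θ P) (hθ : θ.IsAdmissible)
    (v : Label M) (d : Fin M) :
    Measurable (Function.uncurry fun ω (t : ℝ) => θ.influence v d (t - X.time ω v)) :=
  (hθ.measurable_influence v d).comp
    (measurable_snd.sub ((hX.measurable_time v).comp measurable_fst))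

theorem meanTriggered_eq (hX : X.IsAncestorHawkes θ P) (hθ : θ.IsAdmissible) (d : Fin M) (t : ℝ) :
    X.meanTriggered θ P d t =
      ∑' v, ∫⁻ ω in {ω | X.Occurs ω v}, θ.influence v d (t - X.time ω v) ∂P := by
  have hm : ∀ v, Measurable fun ω => θ.influence v d (t - X.time ω v) := fun v =>
    (hX.measurable_influence_time hθ v d).comp measurable_prodMk_right
  simp only [meanTriggered, triggeredIntensity_eq]
  rw [lintegral_tsum fun v => ((hm v).indicator (hX.measurableSet_occurs v)).aemeasurable]
  exact tsum_congr fun v => lintegral_indicator (hX.measurableSet_occurs v) _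

theorem measurable_meanTriggered [SFinite P] (hX : X.IsAncestorHawkes θ P) (hθ : θ.IsAdmissible)
    (d : Fin M) : Measurable (X.meanTriggered θ P d) := by
  simp only [funext (hX.meanTriggered_eq hθ d)]
  exact Measurable.tsum fun v => (hX.measurable_influence_time hθ v d).lintegral_prod_left'

/-- Campbell's formula for the immigrants. -/
theorem tsum_lintegral_immigrant (hX : X.IsAncestorHawkes θ P)
    (hmu : ∀ d, AEMeasurable (θ.mu d) volume) (d : Fin M) {f : ℝ → ℝ≥0∞} (hf : Measurable f) :
    ∑' k, ∫⁻ ω in {ω | X.Occurs ω (.immigrant d k)}, f (X.time ω (.immigrant d k)) ∂P =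
      ∫⁻ s, f s * ENNReal.ofReal (θ.mu d s) := by
  classical
  calc ∑' k, ∫⁻ ω in {ω | X.Occurs ω (.immigrant d k)}, f (X.time ω (.immigrant d k)) ∂P
      = ∫⁻ ω, (X.imm d ω).sum f ∂P := by
        have hm : ∀ k, Measurable fun ω => if (X.imm d ω).Has k then f ((X.imm d ω).2 k) else 0 :=
          fun k => Measurable.ite (hX.measurableSet_occurs (.immigrant d k))
            (hf.comp (hX.measurable_time (.immigrant d k))) measurable_const
        simp only [Config.sum]
        rw [lintegral_tsum fun k => (hm k).aemeasurable]
        refine tsum_congr fun k => ?_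
        rw [← lintegral_indicator (hX.measurableSet_occurs _)]
        rfl
    _ = ∫⁻ s, f s * ENNReal.ofReal (θ.mu d s) := by
        rw [(hX.poisson_imm d).lintegral_sum (hX.measurable_imm d) hf,
          lintegral_withDensity_eq_lintegral_mul₀ (hmu d).ennreal_ofReal hf.aemeasurable]
        exact lintegral_congr fun s => mul_comm _ _

/-- Campbell's formula for the triggered events. -/
theorem tsum_lintegral_child (hX : X.IsAncestorHawkes θ P) (hθ : θ.IsAdmissible)
    [IsProbabilityMeasure P] (d : Fin M) {f : ℝ → ℝ≥0∞} (hf : Measurable f) :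
    ∑' p, ∑' k, ∫⁻ ω in {ω | X.Occurs ω (.child p d k)}, f (X.time ω (.child p d k)) ∂P =
      ∫⁻ s, f s * X.meanTriggered θ P d s := by
  have hm := fun p => hX.measurable_influence_time hθ p d
  calc ∑' p, ∑' k, ∫⁻ ω in {ω | X.Occurs ω (.child p d k)}, f (X.time ω (.child p d k)) ∂P
      = ∑' p, ∫⁻ ω in {ω | X.Occurs ω p}, (∫⁻ s, f s * θ.influence p d (s - X.time ω p)) ∂P := by
        refine tsum_congr fun p => ?_
        simp_rw [← lintegral_Ioi_eq_lintegral_influence]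
        exact hX.lintegral_off hθ p d (X.measurableSet_occurs_past p) hf
    -- By Tonelli the inner integral becomes the mean influence of `p` at `s`; summed over `p` it is
    -- the mean triggered intensity.
    _ = ∑' p, ∫⁻ s, f s * ∫⁻ ω in {ω | X.Occurs ω p}, θ.influence p d (s - X.time ω p) ∂P := by
        refine tsum_congr fun p => ?_
        rw [lintegral_lintegral_swap ((hf.comp measurable_snd).mul (hm p)).aemeasurable]
        exact lintegral_congr fun s => lintegral_const_mul _ ((hm p).comp measurable_prodMk_right)
    _ = ∫⁻ s, f s * X.meanTriggered θ P d s := by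
        have hm' : ∀ p, Measurable fun s =>
            f s * ∫⁻ ω in {ω | X.Occurs ω p}, θ.influence p d (s - X.time ω p) ∂P :=
          fun p => hf.mul (hm p).lintegral_prod_left'
        rw [← lintegral_tsum fun p => (hm' p).aemeasurable]
        refine lintegral_congr fun s => ?_
        rw [ENNReal.tsum_mul_left, hX.meanTriggered_eq hθ]

/-- The intensity at `t` sums influences over the events, so both Campbell formulas apply with the
influence on `t` as test function. -/
theorem meanTriggered_renewal (hX : X.IsAncestorHawkes θ P) (hθ : θ.IsAdmissible)
    (hmu : ∀ d, AEMeasurable (θ.mu d) volume) [IsProbabilityMeasure P] (d : Fin M) (t : ℝ) :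
    X.meanTriggered θ P d t =
      (∑ j, ENNReal.ofReal (θ.K j d) * (∫⁻ u in Set.Ioi (0 : ℝ),
          ENNReal.ofReal (θ.g j d u) * ENNReal.ofReal (θ.mu j (t - u)))) +
      (∑ j, ENNReal.ofReal (θ.L j d) * (∫⁻ u in Set.Ioi (0 : ℝ),
          ENNReal.ofReal (θ.h j d u) * X.meanTriggered θ P j (t - u))) := by
  rw [hX.meanTriggered_eq hθ, Label.tsum_eq]
  congr 1
  · refine Finset.sum_congr rfl fun j _ => ?_
    rw [← lintegral_indicator_sub_mul (hθ.K_nonneg j d) (θ.g j d) (fun s => .ofReal (θ.mu j s))]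
    -- The label `.immigrant j 0` stands for every immigrant of dimension `j`: the influence depends
    -- on the dimension and on being triggered only.
    exact hX.tsum_lintegral_immigrant hmu j
      ((hθ.measurable_influence (.immigrant j 0) d).comp (measurable_const.sub measurable_id))
  · refine Finset.sum_congr rfl fun j _ => ?_
    rw [← lintegral_indicator_sub_mul (hθ.L_nonneg j d)]
    exact hX.tsum_lintegral_child hθ j ((hθ.measurable_influence
      (.child (.immigrant j 0) j 0) d).comp (measurable_const.sub measurable_id))

theorem measure_occurs_time_mem (hX : X.IsAncestorHawkes θ P) (v : Label M) {A : Set ℝ}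
    (hA : MeasurableSet A) : P {ω | X.Occurs ω v ∧ X.time ω v ∈ A} =
      ∫⁻ ω in {ω | X.Occurs ω v}, A.indicator 1 (X.time ω v) ∂P := by
  have hT : MeasurableSet {ω | X.time ω v ∈ A} := hX.measurable_time v hA
  calc P {ω | X.Occurs ω v ∧ X.time ω v ∈ A} = P ({ω | X.time ω v ∈ A} ∩ {ω | X.Occurs ω v}) := by
        rw [Set.inter_comm]
        rfl
    _ = ∫⁻ ω in {ω | X.Occurs ω v}, {ω | X.time ω v ∈ A}.indicator 1 ω ∂P := by
        rw [lintegral_indicator_one hT, Measure.restrict_apply hT]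
    _ = _ := rfl

theorem measurableSet_occurs_time_mem (hX : X.IsAncestorHawkes θ P) (v : Label M) {A : Set ℝ}
    (hA : MeasurableSet A) (p : Prop) :
    MeasurableSet {ω | X.Occurs ω v ∧ p ∧ X.time ω v ∈ A} :=
  (hX.measurableSet_occurs v).inter ((MeasurableSet.const p).inter (hX.measurable_time v hA))

theorem lintegral_triggeredCount (hX : X.IsAncestorHawkes θ P) (hθ : θ.IsAdmissible)
    [IsProbabilityMeasure P] (d : Fin M) {A : Set ℝ} (hA : MeasurableSet A) :
    ∫⁻ ω, X.triggeredCount d A ω ∂P = ∫⁻ t in A, X.meanTriggered θ P d t := by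
  rw [← lintegral_indicator_one_mul hA,
    ← hX.tsum_lintegral_child hθ d (measurable_one.indicator hA)]
  refine (lintegral_encard (S := fun v => {ω | X.Occurs ω v ∧ v.IsTriggered ∧ v.dim = d ∧
    X.time ω v ∈ A}) fun v => by
      simpa only [and_assoc] using
        hX.measurableSet_occurs_time_mem v hA (v.IsTriggered ∧ v.dim = d)).trans ?_
  rw [Label.tsum_eq, Finset.sum_eq_zero fun j _ => by simp [Label.IsTriggered], zero_add,
    Finset.sum_eq_single d]
  · refine tsum_congr fun p => tsum_congr fun k => ?_
    rw [← hX.measure_occurs_time_mem _ hA]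
    simp [Label.IsTriggered, Label.dim]
  · intro j _ hj
    simp [Label.dim, hj]
  · simp

theorem lintegral_count (hX : X.IsAncestorHawkes θ P) (hθ : θ.IsAdmissible)
    (hmu : ∀ d, AEMeasurable (θ.mu d) volume) [IsProbabilityMeasure P] (d : Fin M) {A : Set ℝ}
    (hA : MeasurableSet A) :
    ∫⁻ ω, X.count d A ω ∂P = ∫⁻ t in A, X.meanIntensity θ P d t := by
  simp_rw [meanIntensity_eq]
  rw [lintegral_add_right _ (hX.measurable_meanTriggered hθ d), ← lintegral_indicator_one_mul hA,
    ← lintegral_indicator_one_mul hA,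
    ← hX.tsum_lintegral_child hθ d (measurable_one.indicator hA),
    ← hX.tsum_lintegral_immigrant hmu d (measurable_one.indicator hA)]
  refine (lintegral_encard (S := fun v => {ω | X.Occurs ω v ∧ v.dim = d ∧ X.time ω v ∈ A})
    fun v => hX.measurableSet_occurs_time_mem v hA (v.dim = d)).trans ?_
  rw [Label.tsum_eq]
  congr 1
  · rw [Finset.sum_eq_single d]
    · refine tsum_congr fun k => ?_
      rw [← hX.measure_occurs_time_mem _ hA]
      simp [Label.dim]
    · intro j _ hj
      simp [Label.dim, hj]
    · simp
  · rw [Finset.sum_eq_single d]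
    · refine tsum_congr fun p => tsum_congr fun k => ?_
      rw [← hX.measure_occurs_time_mem _ hA]
      simp [Label.dim]
    · intro j _ hj
      simp [Label.dim, hj]
    · simp

/-! ### Local finiteness of the mean triggered intensity. -/

theorem genMean_zero (hX : X.IsAncestorHawkes θ P)
    (hmu : ∀ d, AEMeasurable (θ.mu d) volume) (d : Fin M) {f : ℝ → ℝ≥0∞} (hf : Measurable f) :
    X.genMean P (fun v => {ω | X.Occurs ω v}) 0 d f = ∫⁻ s, f s * ENNReal.ofReal (θ.mu d s) := by
  rw [genMean, Label.tsum_eq, Finset.sum_eq_single d, Finset.sum_eq_zero, add_zero,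
    ← hX.tsum_lintegral_immigrant hmu d hf]
  · simp [Label.depth, Label.dim]
  · intro j _
    simp [Label.depth]
  · intro j _ hj
    simp [Label.dim, hj]
  · simp

/-- Only an inequality, as the right side counts the immigrants too. -/
theorem setLIntegral_meanTriggered_le_tsum_genMean (hX : X.IsAncestorHawkes θ P)
    (hθ : θ.IsAdmissible) [IsProbabilityMeasure P] (d : Fin M) {A : Set ℝ} (hA : MeasurableSet A) :
    ∫⁻ t in A, X.meanTriggered θ P d t ≤
      ∑' n, X.genMean P (fun v => {ω | X.Occurs ω v}) n d (A.indicator 1) := by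
  rw [tsum_genMean, Label.tsum_eq, ← lintegral_indicator_one_mul hA,
    ← hX.tsum_lintegral_child hθ d (measurable_one.indicator hA)]
  refine le_trans ?_ le_add_self
  refine le_trans ?_ (Finset.single_le_sum (fun _ _ => zero_le) (Finset.mem_univ d))
  simp [Label.dim]

theorem exists_setLIntegral_meanTriggered_le (hX : X.IsAncestorHawkes θ P) (hθ : θ.IsAdmissible)
    (hρ : spectralRadius ℂ (θ.L.map (fun x : ℝ => (x : ℂ))) < 1)
    (hmu : ∀ d, AEMeasurable (θ.mu d) volume) [IsProbabilityMeasure P] {T : ℝ}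
    (hC : ∀ j, ∃ C : ℝ≥0, ∀ s ≤ T, ∫⁻ t in Set.Ioc (s - 1) s, ENNReal.ofReal (θ.mu j t) ≤ C)
    (d : Fin M) :
    ∃ C : ℝ≥0, ∀ s ≤ T, ∫⁻ t in Set.Ioc (s - 1) s, X.meanTriggered θ P d t ≤ C := by
  -- Delays are positive, so translating a test function moves its window into the past, where the
  -- bound still applies.
  let Φ : Set (ℝ → ℝ≥0∞) := {f | ∃ s ≤ T, f = (Set.Ioc (s - 1) s).indicator 1}
  have hΦ : ∀ f ∈ Φ, Measurable f := by
    rintro f ⟨s, -, rfl⟩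
    exact measurable_one.indicator measurableSet_Ioc
  have h := hX.tsum_iSup_genMean_lt_top hθ hρ (A := fun v => {ω | X.Occurs ω v})
    X.measurableSet_occurs_past (m := 0) (fun p d k _ => subset_rfl) hΦ ?_ ?_ d
  · refine ⟨(∑' n, ⨆ f ∈ Φ, X.genMean P (fun v => {ω | X.Occurs ω v}) n d f).toNNReal,
      fun s hs => ?_⟩
    rw [ENNReal.coe_toNNReal h.ne]
    refine (hX.setLIntegral_meanTriggered_le_tsum_genMean hθ d measurableSet_Ioc).trans
      (ENNReal.tsum_le_tsum fun n => ?_)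
    exact le_iSup₂ (f := fun f (_ : f ∈ Φ) =>
      X.genMean P (fun v => {ω | X.Occurs ω v}) n d f) _ ⟨s, hs, rfl⟩
  · rintro f ⟨s, hs, rfl⟩ u hu
    refine ⟨s - u, by linarith, ?_⟩
    funext t
    have : t + u ∈ Set.Ioc (s - 1) s ↔ t ∈ Set.Ioc (s - u - 1) (s - u) := by
      simp only [Set.mem_Ioc]
      constructor <;> rintro ⟨h1, h2⟩ <;> constructor <;> linarith
    by_cases ht : t ∈ Set.Ioc (s - u - 1) (s - u)
    · rw [Set.indicator_of_mem ht, Set.indicator_of_mem (this.2 ht)]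
      rfl
    · rw [Set.indicator_of_notMem ht, Set.indicator_of_notMem (mt this.1 ht)]
  · intro n hn j
    obtain rfl : n = 0 := Nat.le_zero.1 hn
    obtain ⟨C, hC⟩ := hC j
    refine lt_of_le_of_lt (iSup₂_le ?_) (ENNReal.coe_lt_top (r := C))
    rintro f ⟨s, hs, rfl⟩
    rw [hX.genMean_zero hmu j (measurable_one.indicator measurableSet_Ioc),
      lintegral_indicator_one_mul measurableSet_Ioc]
    exact hC s hs

end IsAncestorHawkes

end ClusterSystem

end AncestorHawkes

end

theorem mainTheorem1 {M : ℕ} (θ : AncestorHawkes.Params M)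
    (hmu_nonneg : ∀ d t, 0 ≤ θ.mu d t)
    (hmu : ∀ d, LocallyIntegrable (θ.mu d) volume)
    (hK : ∀ j d, 0 ≤ θ.K j d) (hL : ∀ j d, 0 ≤ θ.L j d)
    (hg_meas : ∀ j d, Measurable (θ.g j d)) (hh_meas : ∀ j d, Measurable (θ.h j d))
    (hg_nonneg : ∀ j d u, 0 < u → 0 ≤ θ.g j d u) (hh_nonneg : ∀ j d u, 0 < u → 0 ≤ θ.h j d u)
    (hg_one : ∀ j d, ∫ u in Set.Ioi (0 : ℝ), θ.g j d u = 1)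
    (hh_one : ∀ j d, ∫ u in Set.Ioi (0 : ℝ), θ.h j d u = 1)
    (hρ : spectralRadius ℂ (θ.L.map (fun x : ℝ => (x : ℂ))) < 1)
    {Ω : Type*} [MeasurableSpace Ω] (P : Measure Ω) [IsProbabilityMeasure P]
    (X : AncestorHawkes.ClusterSystem M Ω) (hX : X.IsAncestorHawkes θ P) :
    -- subcriticality: the branching process of every event has finite expected total size
    (∀ v, (∫⁻ ω, X.clusterSize v ω ∂P) < ∞) ∧
    -- the renewal system
    (∀ d t, X.meanTriggered θ P d t =
      (∑ j, ENNReal.ofReal (θ.K j d) * (∫⁻ u in Set.Ioi (0 : ℝ),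
          ENNReal.ofReal (θ.g j d u) * ENNReal.ofReal (θ.mu j (t - u)))) +
      (∑ j, ENNReal.ofReal (θ.L j d) * (∫⁻ u in Set.Ioi (0 : ℝ),
          ENNReal.ofReal (θ.h j d u) * X.meanTriggered θ P j (t - u)))) ∧
    -- the mean total intensity
    (∀ d t, X.meanIntensity θ P d t = ENNReal.ofReal (θ.mu d t) + X.meanTriggered θ P d t) ∧
    -- these are the intensities of the expected numbers of triggered and of all events
    (∀ d (A : Set ℝ), MeasurableSet A →
      (∫⁻ ω, X.triggeredCount d A ω ∂P) = (∫⁻ t in A, X.meanTriggered θ P d t) ∧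
      (∫⁻ ω, X.count d A ω ∂P) = (∫⁻ t in A, X.meanIntensity θ P d t)) ∧
    -- the mean triggered intensities are locally integrable if the background rates are bounded
    -- on average in the past (for instance if they vanish at negative times, or are bounded)
    ((∀ j, ∀ T : ℝ, ∃ C : ℝ≥0, ∀ s ≤ T,
        (∫⁻ t in Set.Ioc (s - 1) s, ENNReal.ofReal (θ.mu j t)) ≤ C) →
      ∀ d, ∀ T : ℝ, ∃ C : ℝ≥0, ∀ s ≤ T,
        (∫⁻ t in Set.Ioc (s - 1) s, X.meanTriggered θ P d t) ≤ C) := by 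
  have hθ : θ.IsAdmissible := ⟨hK, hL, hg_meas, hh_meas, hg_nonneg, hh_nonneg, hg_one, hh_one⟩
  have hmu' : ∀ d, AEMeasurable (θ.mu d) volume := fun d =>
    (hmu d).aestronglyMeasurable.aemeasurable
  exact ⟨fun v => hX.lintegral_clusterSize_lt_top hθ hρ v,
    fun d t => hX.meanTriggered_renewal hθ hmu' d t,
    fun d t => AncestorHawkes.ClusterSystem.meanIntensity_eq d t,
    fun d A hA => ⟨hX.lintegral_triggeredCount hθ d hA, hX.lintegral_count hθ hmu' d hA⟩,
    fun hC d T => hX.exists_setLIntegral_meanTriggered_le hθ hρ hmu' (fun j => hC j T) d⟩
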